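/- Let $\mathbb{X}$ be a semi-abelian category, that is, a category with a zero object and finite coproducts which is Barr exact and Bourn protomodular. A cospan is a pair of morphisms $(x\colon X\to D,\ y\colon Y\to D)$; a weighted cospan $(x,y,w)$ consists of a cospan $(x,y)$ and a morphism $w\colon W\to D$, its weight. The morphisms $x,y$ *Huq-commute* if there is $\varphi\colon X\times Y\to D$ with $\varphi\circ\langle 1_X,0\rangle=x$ and $\varphi\circ\langle 0,1_Y\rangle=y$. They *commute over* $w$ if there is a morphism $\varphi\colon (W+X)\times_W(W+Y)\to D$, the pullback being taken along $f=[1_W,0]\colon W+X\to W$ and $g=[1_W,0]\colon W+Y\to W$, such that $\varphi\circ\langle 1_{W+X},\iota_W f\rangle=[w,x]$ and $\varphi\circ\langle \iota_W g,1_{W+Y}\rangle=[w,y]$, where $\iota_W$ denotes the coproduct inclusions of $W$. For subobjects $k\colon K\to D$, $l\colon L\to D$, $m\colon M\to D$, the Higgins commutator $[K,L]\leq D$ is the image of the restriction of $[k,l]\colon K+L\to D$ to the kernel of the canonical morphism $K+L\to K\times L$, and the ternary commutator $[K,L,M]\leq D$ is the image of the restriction of $[k,l,m]\colon K+L+M\to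 D$ to the kernel of the canonical morphism $K+L+M\to (K+L)\times(K+M)\times(L+M)$, whose components send the missing summand to zero and include the other two. Then the following conditions on $\mathbb{X}$ are equivalent: 1. for every weighted cospan $(x,y,w)$, if $x$ and $y$ Huq-commute then they commute over $w$; 2. for every cospan $(x,y)$, the property of commuting over $w$ is independent of the weight: for all $w\colon W\to D$ and $w'\colon W'\to D$, $x$ and $y$ commute over $w$ if and only if they commute over $w'$; 3. for every weighted cospan $(x,y,w)$, if $[\mathrm{Im}(x),\mathrm{Im}(y)]=0$ then $[\mathrm{Im}(x),\mathrm{Im}(y),\mathrm{Im}(w)]=0$; 4. any one of the conditions 1, 2, 3 restricted to those cospans $(x,y)$ in which $x$ and $y$ are monomorphisms (the weights $w$, $w'$ remaining arbitrary). -/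

import Mathlib

open CategoryTheory CategoryTheory.Limits

universe v u

noncomputable section

/-- A semi-abelian category (Janelidze, Márki, Tholen): a category with a zero object and finite
coproducts which is Barr exact (regular, and every internal equivalence relation is a kernel pair)
and Bourn protomodular. For a pointed category with kernels of split epimorphisms, protomodularity
is the Split Short Five Lemma: a morphism of split epimorphisms which is an isomorphism on the
bases and on the kernels is an isomorphism. The `HasZeroMorphisms` structure is no extra data: it is
unique, and it is forced by the zero object. -/
class SemiAbelian (C : Type u) [Category.{v} C] [HasZeroMorphisms C] : Prop extends
    Regular C, HasZeroObject C where
  /-- Finite coproducts exist. -/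
  hasFiniteCoproducts : HasFiniteCoproducts C
  /-- Barr exactness: every internal equivalence relation is a kernel pair. -/
  exists_isKernelPair : ∀ {R A : C} (p₁ p₂ : R ⟶ A), IsEquivalenceRelation p₁ p₂ →
    ∃ (B : C) (q : A ⟶ B), IsKernelPair q p₁ p₂
  /-- Protomodularity, as the Split Short Five Lemma. -/
  splitShortFive : ∀ {A B A' B' : C} (f : A ⟶ B) (s : B ⟶ A) (f' : A' ⟶ B') (s' : B' ⟶ A')
    (a : A ⟶ A') (b : B ⟶ B') (_ : s ≫ f = 𝟙 B) (_ : s' ≫ f' = 𝟙 B')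
    (w : f ≫ b = a ≫ f') (_ : s ≫ a = b ≫ s'),
    IsIso b → IsIso (kernel.map f f' a b w) → IsIso a

attribute [instance] SemiAbelian.hasFiniteCoproducts

namespace SemiAbelian

variable {C : Type u} [Category.{v} C] [HasZeroMorphisms C] [SemiAbelian C]

/-- `x` and `y` Huq-commute: there is `φ : X × Y ⟶ D` with `φ ∘ ⟨1, 0⟩ = x` and
`φ ∘ ⟨0, 1⟩ = y`. -/
def HuqCommute {X Y D : C} (x : X ⟶ D) (y : Y ⟶ D) : Prop :=
  ∃ φ : X ⨯ Y ⟶ D, prod.lift (𝟙 X) 0 ≫ φ = x ∧ prod.lift 0 (𝟙 Y) ≫ φ = y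

/-- The split epimorphism `[1, 0] : W + X ⟶ W`, with section the coproduct inclusion of `W`. -/
def weightProj (W X : C) : W ⨿ X ⟶ W := coprod.desc (𝟙 W) 0

theorem inl_weightProj (W X : C) : coprod.inl ≫ weightProj W X = 𝟙 W := coprod.inl_desc _ _

/-- `e₁ = ⟨1, ι_W ∘ [1, 0]⟩ : W + X ⟶ (W + X) ×_W (W + Y)`. -/
def weightLeft (W X Y : C) : W ⨿ X ⟶ pullback (weightProj W X) (weightProj W Y) :=
  pullback.lift (𝟙 (W ⨿ X)) (weightProj W X ≫ coprod.inl)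
    (by rw [Category.id_comp, Category.assoc, inl_weightProj, Category.comp_id])

/-- `e₂ = ⟨ι_W ∘ [1, 0], 1⟩ : W + Y ⟶ (W + X) ×_W (W + Y)`. -/
def weightRight (W X Y : C) : W ⨿ Y ⟶ pullback (weightProj W X) (weightProj W Y) :=
  pullback.lift (weightProj W Y ≫ coprod.inl) (𝟙 (W ⨿ Y))
    (by rw [Category.id_comp, Category.assoc, inl_weightProj, Category.comp_id])

/-- `x` and `y` commute over the weight `w`: the triple `([w, x], w, [w, y])` is admissible with
respect to `([1, 0], ι_W, [1, 0], ι_W)`, that is, there is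
`φ : (W + X) ×_W (W + Y) ⟶ D` with `φ ∘ e₁ = [w, x]` and `φ ∘ e₂ = [w, y]`. -/
def CommuteOver {X Y W D : C} (x : X ⟶ D) (y : Y ⟶ D) (w : W ⟶ D) : Prop :=
  ∃ φ : pullback (weightProj W X) (weightProj W Y) ⟶ D,
    weightLeft W X Y ≫ φ = coprod.desc w x ∧ weightRight W X Y ≫ φ = coprod.desc w y

/-- The comparison `K + L ⟶ K × L` given by the identity matrix. -/
def coprodToProd (K L : C) : K ⨿ L ⟶ K ⨯ L :=
  coprod.desc (prod.lift (𝟙 K) 0) (prod.lift 0 (𝟙 L))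

/-- The comparison `K + L + M ⟶ (K + L) × (K + M) × (L + M)`, whose components send the summand
that is missing in the codomain to zero and include the other two. Its kernel is the ternary
co-smash product. -/
def coprodToProd₃ (K L M : C) : (K ⨿ L) ⨿ M ⟶ (K ⨿ L) ⨯ ((K ⨿ M) ⨯ (L ⨿ M)) :=
  prod.lift (coprod.desc (𝟙 (K ⨿ L)) 0)
    (prod.lift (coprod.desc (coprod.desc coprod.inl 0) coprod.inr)
      (coprod.desc (coprod.desc 0 coprod.inl) coprod.inr))

/-- The binary Higgins commutator `[K, L]` of two subobjects of `D`: the image of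
`K ⋄ L ⟶ K + L ⟶ D`, where `K ⋄ L` is the kernel of `K + L ⟶ K × L`. -/
def higgins {D : C} (K L : Subobject D) : Subobject D :=
  imageSubobject (kernel.ι (coprodToProd (K : C) (L : C)) ≫ coprod.desc K.arrow L.arrow)

/-- The ternary Higgins commutator `[K, L, M]` of three subobjects of `D`: the image of
`K ⋄ L ⋄ M ⟶ K + L + M ⟶ D`. -/
def higgins₃ {D : C} (K L M : Subobject D) : Subobject D :=
  imageSubobject (kernel.ι (coprodToProd₃ (K : C) (L : C) (M : C)) ≫
    coprod.desc (coprod.desc K.arrow L.arrow) M.arrow)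

end SemiAbelian

end

/-! By protomodularity the canonical morphism `X + Y + W ⟶ (W + X) ×_W (W + Y)` is a regular
epimorphism, hence the cokernel of its kernel `N`. Restricting `X + Y + W ⟶ X + Y` to `N` gives a
split epimorphism onto the co-smash product `X ⋄ Y`, whose kernel is the ternary co-smash product
`X ⋄ Y ⋄ W`, so a morphism vanishes on `N` as soon as it vanishes on both. Hence `x` and `y` commute
over `w` if and only if they Huq-commute and `X ⋄ Y ⋄ W ⟶ X + Y + W ⟶ D` is zero; for subobjects
these are the two Higgins commutator conditions. The zero weight is neutral, which makes
independence of the weight the same as condition 1. Huq-commutation of a cospan passes to its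
images, and commutation over a weight passes back from the images to the cospan itself. -/

noncomputable section

/-- A homological category in the sense of Borceux and Bourn: a pointed category which is regular
and protomodular, the latter in the form of the Split Short Five Lemma. -/
class Homological (C : Type u) [Category.{v} C] [HasZeroMorphisms C] : Prop extends
    Regular C, HasZeroObject C where
  splitShortFive : ∀ {A B A' B' : C} (f : A ⟶ B) (s : B ⟶ A) (f' : A' ⟶ B') (s' : B' ⟶ A')
    (a : A ⟶ A') (b : B ⟶ B') (_ : s ≫ f = 𝟙 B) (_ : s' ≫ f' = 𝟙 B')
    (w : f ≫ b = a ≫ f') (_ : s ≫ a = b ≫ s'),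
    IsIso b → IsIso (kernel.map f f' a b w) → IsIso a

theorem SemiAbelian.homological (C : Type u) [Category.{v} C] [HasZeroMorphisms C]
    [SemiAbelian C] : Homological C where
  splitShortFive := SemiAbelian.splitShortFive

namespace Homological

section Regular

variable {C : Type u} [Category.{v} C] [Regular C]

theorem isRegularEpi_prodMap_id {X X' : C} (e : X ⟶ X') [IsRegularEpi e] (Y : C) :
    IsRegularEpi (prod.map e (𝟙 Y)) :=
  Regular.regularEpiIsStableUnderBaseChange.of_isPullback (.of_prod_fst_with_id e Y) ‹_›

instance isRegularEpi_factorThruImageSubobject {X D : C} (x : X ⟶ D) :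
    IsRegularEpi (factorThruImageSubobject x) := by
  have : StrongEpi (factorThruImageSubobject x) := by
    dsimp [factorThruImageSubobject]
    infer_instance
  infer_instance

end Regular

variable {C : Type u} [Category.{v} C] [HasZeroMorphisms C]

attribute [local simp] prod.lift_fst prod.lift_fst_assoc prod.lift_snd prod.lift_snd_assoc
  coprod.inl_desc coprod.inl_desc_assoc coprod.inr_desc coprod.inr_desc_assoc
  pullback.lift_fst pullback.lift_fst_assoc pullback.lift_snd pullback.lift_snd_assoc

section Products

variable [HasBinaryProducts C]

/-- `SemiAbelian.HuqCommute` in any category with zero morphisms and binary products. -/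
def HuqCommute {X Y D : C} (x : X ⟶ D) (y : Y ⟶ D) : Prop :=
  ∃ φ : X ⨯ Y ⟶ D, prod.lift (𝟙 X) 0 ≫ φ = x ∧ prod.lift 0 (𝟙 Y) ≫ φ = y

theorem HuqCommute.symm {X Y D : C} {x : X ⟶ D} {y : Y ⟶ D} (h : HuqCommute x y) :
    HuqCommute y x := by
  obtain ⟨φ, hx, hy⟩ := h
  refine ⟨(prod.braiding Y X).hom ≫ φ, ?_, ?_⟩
  · rw [← hy, ← Category.assoc]
    congr 1
    ext <;> simp
  · rw [← hx, ← Category.assoc]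
    congr 1
    ext <;> simp

theorem kernel_prodMap_id_ι [HasKernels C] {X X' : C} (e : X ⟶ X') (Y : C) :
    kernel.ι (prod.map e (𝟙 Y)) =
      (kernel.ι (prod.map e (𝟙 Y)) ≫ prod.fst) ≫ prod.lift (𝟙 X) 0 := by
  have hsnd : kernel.ι (prod.map e (𝟙 Y)) ≫ prod.snd = 0 := by
    rw [← Category.comp_id prod.snd, ← prod.map_snd e (𝟙 Y), kernel.condition_assoc, zero_comp]
  ext <;> simp [hsnd]

variable [HasBinaryCoproducts C]

/-- `SemiAbelian.coprodToProd` in any category with zero morphisms, binary products and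
binary coproducts. -/
def coprodToProd (K L : C) : K ⨿ L ⟶ K ⨯ L :=
  coprod.desc (prod.lift (𝟙 K) 0) (prod.lift 0 (𝟙 L))

/-- `SemiAbelian.coprodToProd₃` in any category with zero morphisms, binary products and
binary coproducts. -/
def coprodToProd₃ (K L M : C) : (K ⨿ L) ⨿ M ⟶ (K ⨿ L) ⨯ ((K ⨿ M) ⨯ (L ⨿ M)) :=
  prod.lift (coprod.desc (𝟙 (K ⨿ L)) 0)
    (prod.lift (coprod.desc (coprod.desc coprod.inl 0) coprod.inr)
      (coprod.desc (coprod.desc 0 coprod.inl) coprod.inr))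

theorem huqCommute_iff_exists {X Y D : C} (x : X ⟶ D) (y : Y ⟶ D) :
    HuqCommute x y ↔ ∃ φ, coprodToProd X Y ≫ φ = coprod.desc x y := by
  simp [HuqCommute, coprodToProd, coprod.hom_ext_iff]

end Products

section Coproducts

variable [HasBinaryCoproducts C]

/-- `SemiAbelian.weightProj` in any category with zero morphisms and binary coproducts. -/
def weightProj (W X : C) : W ⨿ X ⟶ W := coprod.desc (𝟙 W) 0

@[simp]
theorem inl_weightProj (W X : C) : coprod.inl ≫ weightProj W X = 𝟙 W := coprod.inl_desc _ _

@[simp]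
theorem inr_weightProj (W X : C) : coprod.inr ≫ weightProj W X = 0 := coprod.inr_desc _ _

theorem map_weightProj {W X W' X' : C} (c : W ⟶ W') (a : X ⟶ X') :
    coprod.map c a ≫ weightProj W' X' = weightProj W X ≫ c := by
  ext <;> simp [weightProj]

variable [HasPullbacks C]

/-- `SemiAbelian.weightLeft` in any category with zero morphisms, pullbacks and binary
coproducts. -/
def weightLeft (W X Y : C) : W ⨿ X ⟶ pullback (weightProj W X) (weightProj W Y) :=
  pullback.lift (𝟙 (W ⨿ X)) (weightProj W X ≫ coprod.inl) (by simp)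

/-- `SemiAbelian.weightRight` in any category with zero morphisms, pullbacks and binary
coproducts. -/
def weightRight (W X Y : C) : W ⨿ Y ⟶ pullback (weightProj W X) (weightProj W Y) :=
  pullback.lift (weightProj W Y ≫ coprod.inl) (𝟙 (W ⨿ Y)) (by simp)

/-- `SemiAbelian.CommuteOver` in any category with zero morphisms, pullbacks and binary
coproducts. -/
def CommuteOver {X Y W D : C} (x : X ⟶ D) (y : Y ⟶ D) (w : W ⟶ D) : Prop :=
  ∃ φ : pullback (weightProj W X) (weightProj W Y) ⟶ D,
    weightLeft W X Y ≫ φ = coprod.desc w x ∧ weightRight W X Y ≫ φ = coprod.desc w y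

/-- The canonical morphism `X + Y + W ⟶ (W + X) ×_W (W + Y)`, whose components send `Y`,
respectively `X`, to zero. -/
def coprodToPullback (X Y W : C) :
    (X ⨿ Y) ⨿ W ⟶ pullback (weightProj W X) (weightProj W Y) :=
  pullback.lift (coprod.desc (coprod.desc coprod.inr 0) coprod.inl)
    (coprod.desc (coprod.desc 0 coprod.inr) coprod.inl) (by ext <;> simp)

theorem desc_inr_inl_coprodToPullback (X Y W : C) :
    coprod.desc coprod.inr (coprod.inl ≫ coprod.inl) ≫ coprodToPullback X Y W =
      weightLeft W X Y := by
  ext <;> simp [coprodToPullback, weightLeft, reassoc_of% inl_weightProj W X,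
    reassoc_of% inr_weightProj W X]

theorem desc_inr_inr_coprodToPullback (X Y W : C) :
    coprod.desc coprod.inr (coprod.inr ≫ coprod.inl) ≫ coprodToPullback X Y W =
      weightRight W X Y := by
  ext <;> simp [coprodToPullback, weightRight, reassoc_of% inl_weightProj W Y,
    reassoc_of% inr_weightProj W Y]

theorem commuteOver_iff_exists {X Y W D : C} (x : X ⟶ D) (y : Y ⟶ D) (w : W ⟶ D) :
    CommuteOver x y w ↔
      ∃ φ, coprodToPullback X Y W ≫ φ = coprod.desc (coprod.desc x y) w := by
  refine exists_congr fun φ => ?_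
  rw [← desc_inr_inl_coprodToPullback, ← desc_inr_inr_coprodToPullback]
  simp only [coprod.hom_ext_iff, coprod.desc_comp, coprod.inl_desc, coprod.inr_desc, Category.assoc]
  tauto

theorem map_coprodToPullback {X Y W X' Y' W' : C} (a : X ⟶ X') (b : Y ⟶ Y') (c : W ⟶ W') :
    coprod.map (coprod.map a b) c ≫ coprodToPullback X' Y' W' =
      coprodToPullback X Y W ≫ pullback.map _ _ _ _ (coprod.map c a) (coprod.map c b) c
        (map_weightProj c a).symm (map_weightProj c b).symm := by
  ext <;> simp [coprodToPullback]

theorem CommuteOver.precomp {X Y W X' Y' W' D : C} {x : X' ⟶ D} {y : Y' ⟶ D} {w : W' ⟶ D}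
    (h : CommuteOver x y w) (a : X ⟶ X') (b : Y ⟶ Y') (c : W ⟶ W') :
    CommuteOver (a ≫ x) (b ≫ y) (c ≫ w) := by
  obtain ⟨φ, hφ⟩ := (commuteOver_iff_exists x y w).1 h
  refine (commuteOver_iff_exists _ _ _).2 ⟨pullback.map _ _ _ _ (coprod.map c a)
    (coprod.map c b) c (map_weightProj c a).symm (map_weightProj c b).symm ≫ φ, ?_⟩
  rw [← Category.assoc, ← map_coprodToPullback, Category.assoc, hφ]
  simp

variable [HasBinaryProducts C]

/-- The inclusion of `X × Y`, the fibre over zero, into `(W + X) ×_W (W + Y)`. -/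
def prodToPullback (X Y W : C) : X ⨯ Y ⟶ pullback (weightProj W X) (weightProj W Y) :=
  pullback.lift (prod.fst ≫ coprod.inr) (prod.snd ≫ coprod.inr) (by simp)

/-- The retraction of `prodToPullback X Y W` which sends `W` to zero. -/
def pullbackToProd (X Y W : C) : pullback (weightProj W X) (weightProj W Y) ⟶ X ⨯ Y :=
  prod.lift (pullback.fst _ _ ≫ coprod.desc 0 (𝟙 X)) (pullback.snd _ _ ≫ coprod.desc 0 (𝟙 Y))

theorem inl_coprodToPullback (X Y W : C) :
    coprod.inl ≫ coprodToPullback X Y W = coprodToProd X Y ≫ prodToPullback X Y W := by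
  ext <;> simp [coprodToPullback, coprodToProd, prodToPullback]

theorem coprodToPullback_pullbackToProd (X Y W : C) :
    coprodToPullback X Y W ≫ pullbackToProd X Y W = coprod.desc (𝟙 _) 0 ≫ coprodToProd X Y := by
  ext <;> simp [coprodToPullback, coprodToProd, pullbackToProd]

theorem CommuteOver.huqCommute {X Y W D : C} {x : X ⟶ D} {y : Y ⟶ D} {w : W ⟶ D}
    (h : CommuteOver x y w) : HuqCommute x y := by
  obtain ⟨φ, hφ⟩ := (commuteOver_iff_exists x y w).1 h
  refine (huqCommute_iff_exists x y).2 ⟨prodToPullback X Y W ≫ φ, ?_⟩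
  rw [← Category.assoc, ← inl_coprodToPullback, Category.assoc, hφ, coprod.inl_desc]

theorem comp_coprodToProd₃_eq_zero_iff {T X Y W : C} (t : T ⟶ (X ⨿ Y) ⨿ W) :
    t ≫ coprodToProd₃ X Y W = 0 ↔
      t ≫ coprod.desc (𝟙 (X ⨿ Y)) 0 = 0 ∧ t ≫ coprodToPullback X Y W = 0 := by
  have hX : coprod.desc (coprod.desc coprod.inl 0) coprod.inr =
      coprodToPullback X Y W ≫ pullback.fst _ _ ≫ (coprod.braiding W X).hom := by
    ext <;> simp [coprodToPullback]
  have hY : coprod.desc (coprod.desc 0 coprod.inl) coprod.inr =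
      coprodToPullback X Y W ≫ pullback.snd _ _ ≫ (coprod.braiding W Y).hom := by
    ext <;> simp [coprodToPullback]
  rw [coprodToProd₃, hX, hY, prod.hom_ext_iff, prod.hom_ext_iff, pullback.hom_ext_iff,
    ← cancel_mono (coprod.braiding W X).hom, ← cancel_mono (coprod.braiding W Y).hom]
  simp only [prod.comp_lift, prod.lift_fst, prod.lift_snd, zero_comp, Category.assoc]

end Coproducts

section SplitEpi

variable [Homological C]

theorem isIso_of_section_of_kernel {A B S : C} (f : A ⟶ B) (s : B ⟶ A) (hs : s ≫ f = 𝟙 B)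
    (m : S ⟶ A) [Mono m] (t : B ⟶ S) (ht : t ≫ m = s)
    (k : kernel f ⟶ S) (hk : k ≫ m = kernel.ι f) : IsIso m := by
  have hkm : k ≫ m ≫ f = 0 := by rw [← Category.assoc, hk, kernel.condition]
  refine splitShortFive (m ≫ f) t f s m (𝟙 B) (by rw [← Category.assoc, ht, hs]) hs
    (by simp) (by simp [ht]) inferInstance ⟨kernel.lift _ k hkm, ?_, ?_⟩
  · rw [← cancel_mono (kernel.ι (m ≫ f)), ← cancel_mono m]
    simp [hk]
  · rw [← cancel_mono (kernel.ι f)]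
    simp [hk]

theorem isRegularEpi_of_section_of_kernel {Z A B : C} (q : Z ⟶ A) (f : A ⟶ B) (s : B ⟶ A)
    (hs : s ≫ f = 𝟙 B) (t : B ⟶ Z) (ht : t ≫ q = s) (k : kernel f ⟶ Z)
    (hk : k ≫ q = kernel.ι f) : IsRegularEpi q := by
  have : ExtremalEpi q := .mk_of_hasEqualizers q fun S e m h _ =>
    isIso_of_section_of_kernel f s hs m (t ≫ e) (by simp [h, ht]) (k ≫ e) (by simp [h, hk])
  infer_instance

theorem hom_ext_of_section_of_kernel {A B D : C} (f : A ⟶ B) (s : B ⟶ A) (hs : s ≫ f = 𝟙 B)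
    {g h : A ⟶ D} (hsec : s ≫ g = s ≫ h) (hker : kernel.ι f ≫ g = kernel.ι f ≫ h) : g = h := by
  have := isRegularEpi_of_section_of_kernel (equalizer.ι g h) f s hs
    (equalizer.lift s hsec) (equalizer.lift_ι _ _)
    (equalizer.lift (kernel.ι f) hker) (equalizer.lift_ι _ _)
  rw [← cancel_epi (equalizer.ι g h), equalizer.condition]

theorem exists_comp_eq_iff_kernel_comp_eq_zero {A B D : C} (q : A ⟶ B) [IsRegularEpi q]
    (g : A ⟶ D) : (∃ φ, q ≫ φ = g) ↔ kernel.ι q ≫ g = 0 := by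
  refine ⟨?_, fun hg => ?_⟩
  · rintro ⟨φ, rfl⟩
    rw [kernel.condition_assoc, zero_comp]
  have hpair : pullback.fst q q ≫ g = pullback.snd q q ≫ g := by
    refine hom_ext_of_section_of_kernel (pullback.snd q q) (pullback.lift (𝟙 A) (𝟙 A) rfl)
      (by simp) (by simp) ?_
    have hfst : (kernel.ι (pullback.snd q q) ≫ pullback.fst q q) ≫ q = 0 := by
      rw [Category.assoc, pullback.condition, kernel.condition_assoc, zero_comp]
    rw [kernel.condition_assoc, zero_comp, ← Category.assoc, ← kernel.lift_ι q _ hfst,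
      Category.assoc, hg, comp_zero]
  refine ⟨IsRegularEpi.desc q g ?_, IsRegularEpi.fac q g _⟩
  simpa using congrArg (pullback.lift _ _ (IsRegularEpi.w q) ≫ ·) hpair

end SplitEpi

section Commutators

variable [Homological C] [HasBinaryCoproducts C]

instance isRegularEpi_coprodToProd (X Y : C) : IsRegularEpi (coprodToProd X Y) := by
  refine isRegularEpi_of_section_of_kernel _ prod.snd (prod.lift 0 (𝟙 Y)) (by simp)
    coprod.inr (coprod.inr_desc _ _) (kernel.ι prod.snd ≫ prod.fst ≫ coprod.inl) ?_
  ext <;> simp [coprodToProd]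

instance isRegularEpi_coprodToPullback (X Y W : C) : IsRegularEpi (coprodToPullback X Y W) := by
  refine isRegularEpi_of_section_of_kernel _ (pullback.snd _ _) (weightRight W X Y)
    (pullback.lift_snd _ _ _) _ (desc_inr_inr_coprodToPullback X Y W)
    (kernel.ι _ ≫ pullback.fst _ _ ≫ coprod.desc coprod.inr (coprod.inl ≫ coprod.inl)) ?_
  rw [Category.assoc, Category.assoc, desc_inr_inl_coprodToPullback]
  ext <;> simp [weightLeft, pullback.condition_assoc]

theorem huqCommute_iff_kernel_comp_eq_zero {X Y D : C} (x : X ⟶ D) (y : Y ⟶ D) :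
    HuqCommute x y ↔ kernel.ι (coprodToProd X Y) ≫ coprod.desc x y = 0 :=
  (huqCommute_iff_exists x y).trans (exists_comp_eq_iff_kernel_comp_eq_zero _ _)

theorem commuteOver_iff_kernel_comp_eq_zero {X Y W D : C} (x : X ⟶ D) (y : Y ⟶ D) (w : W ⟶ D) :
    CommuteOver x y w ↔
      kernel.ι (coprodToPullback X Y W) ≫ coprod.desc (coprod.desc x y) w = 0 :=
  (commuteOver_iff_exists x y w).trans (exists_comp_eq_iff_kernel_comp_eq_zero _ _)

/-- The inclusion of the co-smash product of `X` and `Y` splits the restriction of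
`X + Y + W ⟶ X + Y` to the kernel of `coprodToPullback X Y W`, and the kernel of that restriction
is the ternary co-smash product. -/
theorem kernel_coprodToPullback_comp_eq_zero_iff {X Y W D : C} (g : (X ⨿ Y) ⨿ W ⟶ D) :
    kernel.ι (coprodToPullback X Y W) ≫ g = 0 ↔
      kernel.ι (coprodToProd X Y) ≫ coprod.inl ≫ g = 0 ∧
        kernel.ι (coprodToProd₃ X Y W) ≫ g = 0 := by
  let r : kernel (coprodToPullback X Y W) ⟶ kernel (coprodToProd X Y) :=
    kernel.map _ _ _ _ (coprodToPullback_pullbackToProd X Y W)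
  let s : kernel (coprodToProd X Y) ⟶ kernel (coprodToPullback X Y W) :=
    kernel.map _ _ _ _ (inl_coprodToPullback X Y W).symm
  have hr : r ≫ kernel.ι _ = kernel.ι _ ≫ coprod.desc (𝟙 _) 0 := kernel.lift_ι _ _ _
  have hs : s ≫ kernel.ι _ = kernel.ι _ ≫ coprod.inl := kernel.lift_ι _ _ _
  have hsr : s ≫ r = 𝟙 _ := by
    rw [← cancel_mono (kernel.ι _), Category.assoc, hr, reassoc_of% hs]
    simp
  have hker : (kernel.ι r ≫ kernel.ι _) ≫ coprodToProd₃ X Y W = 0 := by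
    rw [comp_coprodToProd₃_eq_zero_iff, Category.assoc, Category.assoc, ← hr,
      kernel.condition_assoc, kernel.condition, zero_comp, comp_zero]
    exact ⟨rfl, rfl⟩
  refine ⟨fun hg => ⟨?_, ?_⟩, fun ⟨h₂, h₃⟩ => ?_⟩
  · rw [← reassoc_of% hs, hg, comp_zero]
  · rw [← kernel.lift_ι _ _ ((comp_coprodToProd₃_eq_zero_iff _).1 (kernel.condition _)).2,
      Category.assoc, hg, comp_zero]
  · refine hom_ext_of_section_of_kernel r s hsr ?_ ?_
    · rw [reassoc_of% hs, h₂, comp_zero]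
    · rw [← Category.assoc, ← kernel.lift_ι _ _ hker, Category.assoc, h₃, comp_zero, comp_zero]

theorem commuteOver_iff_huqCommute_and {X Y W D : C} (x : X ⟶ D) (y : Y ⟶ D) (w : W ⟶ D) :
    CommuteOver x y w ↔ HuqCommute x y ∧
      kernel.ι (coprodToProd₃ X Y W) ≫ coprod.desc (coprod.desc x y) w = 0 := by
  rw [commuteOver_iff_kernel_comp_eq_zero, kernel_coprodToPullback_comp_eq_zero_iff,
    coprod.inl_desc, huqCommute_iff_kernel_comp_eq_zero]

/-- The weight `0 ⟶ D` is neutral: `X + Y + 0` is `X + Y`, so its ternary co-smash product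
vanishes. -/
theorem HuqCommute.commuteOver_of_isZero {X Y Z D : C} {x : X ⟶ D} {y : Y ⟶ D}
    (h : HuqCommute x y) (hZ : IsZero Z) (w : Z ⟶ D) : CommuteOver x y w := by
  refine (commuteOver_iff_huqCommute_and x y w).2 ⟨h, ?_⟩
  have hdesc : coprod.desc (coprod.desc x y) w = coprod.desc (𝟙 (X ⨿ Y)) 0 ≫ coprod.desc x y := by
    ext1
    · simp
    · exact hZ.eq_of_src _ _
  rw [hdesc, reassoc_of% ((comp_coprodToProd₃_eq_zero_iff _).1 (kernel.condition _)).1, zero_comp]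

theorem forall_commuteOver_iff_weight_independent {X Y D : C} (x : X ⟶ D) (y : Y ⟶ D) :
    (∀ (W : C) (w : W ⟶ D), HuqCommute x y → CommuteOver x y w) ↔
      ∀ (W W' : C) (w : W ⟶ D) (w' : W' ⟶ D), CommuteOver x y w ↔ CommuteOver x y w' := by
  refine ⟨fun h W W' w w' => ⟨fun hw => h W' w' hw.huqCommute, fun hw => h W w hw.huqCommute⟩,
    fun h W w hxy => ?_⟩
  obtain ⟨Z, hZ⟩ := HasZeroObject.zero (C := C)
  exact (h Z W 0 w).1 (hxy.commuteOver_of_isZero hZ 0)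

end Commutators

section Images

theorem imageSubobject_eq_bot_iff [HasZeroObject C] [HasImages C] {X D : C} (x : X ⟶ D) :
    imageSubobject x = ⊥ ↔ x = 0 := by
  refine ⟨fun h => (Subobject.bot_factors_iff_zero x).1 ?_, ?_⟩
  · simpa [h] using imageSubobject_factors_comp_self x (𝟙 X)
  · rintro rfl
    exact imageSubobject_zero

variable [Homological C]

theorem HuqCommute.of_isRegularEpi_comp {X X' Y D : C} (e : X ⟶ X') [IsRegularEpi e]
    {x : X' ⟶ D} {y : Y ⟶ D} (h : HuqCommute (e ≫ x) y) : HuqCommute x y := by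
  obtain ⟨φ, hx, hy⟩ := h
  have := isRegularEpi_prodMap_id e Y
  have hker : kernel.ι (prod.map e (𝟙 Y)) ≫ φ = 0 := by
    rw [kernel_prodMap_id_ι, Category.assoc, Category.assoc, hx, ← prod.map_fst_assoc e (𝟙 Y),
      kernel.condition_assoc, zero_comp]
  obtain ⟨ψ, rfl⟩ := (exists_comp_eq_iff_kernel_comp_eq_zero _ φ).2 hker
  refine ⟨ψ, ?_, ?_⟩
  · rw [← cancel_epi e, ← hx, ← Category.assoc, ← Category.assoc]
    congr 1
    ext <;> simp
  · rw [← hy, ← Category.assoc]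
    congr 1
    ext <;> simp

theorem HuqCommute.imageSubobject {X Y D : C} {x : X ⟶ D} {y : Y ⟶ D} (h : HuqCommute x y) :
    HuqCommute (imageSubobject x).arrow (imageSubobject y).arrow := by
  refine .of_isRegularEpi_comp (factorThruImageSubobject x) (.symm ?_)
  refine .of_isRegularEpi_comp (factorThruImageSubobject y) (.symm ?_)
  simpa using h

variable [HasBinaryCoproducts C]

/-- `SemiAbelian.higgins` in any homological category with binary coproducts. -/
def higgins {D : C} (K L : Subobject D) : Subobject D :=
  imageSubobject (kernel.ι (coprodToProd (K : C) (L : C)) ≫ coprod.desc K.arrow L.arrow)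

/-- `SemiAbelian.higgins₃` in any homological category with binary coproducts. -/
def higgins₃ {D : C} (K L M : Subobject D) : Subobject D :=
  imageSubobject (kernel.ι (coprodToProd₃ (K : C) (L : C) (M : C)) ≫
    coprod.desc (coprod.desc K.arrow L.arrow) M.arrow)

theorem higgins_eq_bot_iff {D : C} (K L : Subobject D) :
    higgins K L = ⊥ ↔ HuqCommute K.arrow L.arrow := by
  rw [higgins, imageSubobject_eq_bot_iff, huqCommute_iff_kernel_comp_eq_zero]

theorem commuteOver_arrow_iff {D : C} (K L M : Subobject D) :
    CommuteOver K.arrow L.arrow M.arrow ↔ higgins K L = ⊥ ∧ higgins₃ K L M = ⊥ := by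
  rw [higgins_eq_bot_iff, higgins₃, imageSubobject_eq_bot_iff, commuteOver_iff_huqCommute_and]

theorem commuteOver_of_higgins₃_imageSubobject {X Y W D : C} {x : X ⟶ D} {y : Y ⟶ D} {w : W ⟶ D}
    (h₂ : higgins (imageSubobject x) (imageSubobject y) = ⊥)
    (h₃ : higgins₃ (imageSubobject x) (imageSubobject y) (imageSubobject w) = ⊥) :
    CommuteOver x y w := by
  simpa using ((commuteOver_arrow_iff _ _ _).2 ⟨h₂, h₃⟩).precomp (factorThruImageSubobject x)
    (factorThruImageSubobject y) (factorThruImageSubobject w)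

end Images

end Homological

end

open Homological in
theorem proposition4p1_general (C : Type u) [Category.{v} C] [HasZeroMorphisms C] [Homological C]
    [HasBinaryCoproducts C] :
    List.TFAE [
      ∀ (X Y W D : C) (x : X ⟶ D) (y : Y ⟶ D) (w : W ⟶ D),
        HuqCommute x y → CommuteOver x y w,
      ∀ (X Y D : C) (x : X ⟶ D) (y : Y ⟶ D) (W W' : C) (w : W ⟶ D) (w' : W' ⟶ D),
        CommuteOver x y w ↔ CommuteOver x y w',
      ∀ (X Y W D : C) (x : X ⟶ D) (y : Y ⟶ D) (w : W ⟶ D),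
        higgins (imageSubobject x) (imageSubobject y) = ⊥ →
          higgins₃ (imageSubobject x) (imageSubobject y) (imageSubobject w) = ⊥,
      ∀ (X Y W D : C) (x : X ⟶ D) (y : Y ⟶ D) (w : W ⟶ D), Mono x → Mono y →
        HuqCommute x y → CommuteOver x y w,
      ∀ (X Y D : C) (x : X ⟶ D) (y : Y ⟶ D), Mono x → Mono y →
        ∀ (W W' : C) (w : W ⟶ D) (w' : W' ⟶ D),
          CommuteOver x y w ↔ CommuteOver x y w',
      ∀ (X Y W D : C) (x : X ⟶ D) (y : Y ⟶ D) (w : W ⟶ D), Mono x → Mono y →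
        higgins (imageSubobject x) (imageSubobject y) = ⊥ →
          higgins₃ (imageSubobject x) (imageSubobject y) (imageSubobject w) = ⊥] := by
  tfae_have 1 ↔ 2 := by
    simp only [← forall_commuteOver_iff_weight_independent]
    exact ⟨fun h X Y D x y W w => h X Y W D x y w, fun h X Y W D x y w => h X Y D x y W w⟩
  tfae_have 4 ↔ 5 := by
    simp only [← forall_commuteOver_iff_weight_independent]
    exact ⟨fun h X Y D x y hx hy W w => h X Y W D x y w hx hy,
      fun h X Y W D x y w hx hy => h X Y D x y hx hy W w⟩
  tfae_have 1 → 4 := fun h X Y W D x y w _ _ => h X Y W D x y w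
  tfae_have 3 → 6 := fun h X Y W D x y w _ _ => h X Y W D x y w
  tfae_have 6 → 3 := fun h X Y W D x y w hxy => by
    simpa [imageSubobject_mono] using h _ _ _ _ (imageSubobject x).arrow (imageSubobject y).arrow w
      inferInstance inferInstance (by simpa [imageSubobject_mono] using hxy)
  tfae_have 4 → 3 := fun h X Y W D x y w hxy =>
    ((commuteOver_arrow_iff _ _ _).1 (h _ _ _ _ _ _ (imageSubobject w).arrow
      inferInstance inferInstance ((higgins_eq_bot_iff _ _).1 hxy))).2
  tfae_have 3 → 1 := fun h X Y W D x y w hxy =>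
    have h₂ := (higgins_eq_bot_iff _ _).2 hxy.imageSubobject
    commuteOver_of_higgins₃_imageSubobject h₂ (h X Y W D x y w h₂)
  tfae_finish

theorem proposition4p1 (C : Type u) [Category.{v} C] [HasZeroMorphisms C] [SemiAbelian C] :
    List.TFAE [
      -- weighted cospans: Huq-commuting implies commuting over the weight
      ∀ (X Y W D : C) (x : X ⟶ D) (y : Y ⟶ D) (w : W ⟶ D),
        SemiAbelian.HuqCommute x y → SemiAbelian.CommuteOver x y w,
      -- commuting over a weight does not depend on the weight
      ∀ (X Y D : C) (x : X ⟶ D) (y : Y ⟶ D) (W W' : C) (w : W ⟶ D) (w' : W' ⟶ D),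
        SemiAbelian.CommuteOver x y w ↔ SemiAbelian.CommuteOver x y w',
      -- vanishing of the binary commutator implies vanishing of the ternary one
      ∀ (X Y W D : C) (x : X ⟶ D) (y : Y ⟶ D) (w : W ⟶ D),
        SemiAbelian.higgins (imageSubobject x) (imageSubobject y) = ⊥ →
          SemiAbelian.higgins₃ (imageSubobject x) (imageSubobject y) (imageSubobject w) = ⊥,
      -- the same three conditions for cospans `(x, y)` of monomorphisms
      ∀ (X Y W D : C) (x : X ⟶ D) (y : Y ⟶ D) (w : W ⟶ D), Mono x → Mono y →
        SemiAbelian.HuqCommute x y → SemiAbelian.CommuteOver x y w,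
      ∀ (X Y D : C) (x : X ⟶ D) (y : Y ⟶ D), Mono x → Mono y →
        ∀ (W W' : C) (w : W ⟶ D) (w' : W' ⟶ D),
          SemiAbelian.CommuteOver x y w ↔ SemiAbelian.CommuteOver x y w',
      ∀ (X Y W D : C) (x : X ⟶ D) (y : Y ⟶ D) (w : W ⟶ D), Mono x → Mono y →
        SemiAbelian.higgins (imageSubobject x) (imageSubobject y) = ⊥ →
          SemiAbelian.higgins₃ (imageSubobject x) (imageSubobject y) (imageSubobject w) = ⊥] :=
  have := SemiAbelian.homological C
  proposition4p1_general C
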